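/- **Setting.** A metric space is geodesic if any two of its points are joined by a geodesic segment, that is, by a path $\alpha:[0,L]\to X$ with $d(\alpha(s),\alpha(t))=|s-t|$ for all $s,t$. Let a group $G$ act by isometries on a geodesic metric space $(X,d)$ (not assumed to be proper), and fix a basepoint $p\in X$. * For a nonempty $Y\subseteq X$ and $x\in X$ put $\pi_Y(x)=\{y\in Y: d(x,y)\le d(x,Y)+1\}$. The set $Y$ is *contracting* if there is $C\ge 0$ such that $\operatorname{diam}\bigl(\bigcup_{x\in\alpha}\pi_Y(x)\bigr)\le C$ for every geodesic segment $\alpha$ with $d(\alpha,Y)\ge C$. * An element $g\in G$ is *contracting* if $\langle g\rangle p$ is a contracting subset of $X$ and $n\mapsto g^np$ is a quasi-isometric embedding $\mathbb Z\to X$. * Two contracting elements $g,h$ are *weakly independent* if there is a function $\mathcal R:[0,\infty)\to[0,\infty)$ with $\operatorname{diam}\bigl(N_r(\langle g\rangle p)\cap N_r(\langle h\rangle p)\bigr)\le\mathcal R(r)$ for all $r\ge0$, where $N_r(A)=\{x: d(x,A)\le r\}$. * The action has *contracting property* if $G$ contains two weakly independent contracting elements. * The *stable translation length* of $g\in G$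 is $\ell_d(g)=\lim_{n\to\infty}d(p,g^np)/n$. These notions do not depend on the choice of $p$. **Theorem.** Let a group $G$ act by isometries on two geodesic metric spaces $(X_1,d_1)$ and $(X_2,d_2)$, both actions having contracting property, and let $\mathcal{SC}(G)$ be the set of all $g\in G$ that are contracting for both actions. Suppose that $\lambda_1,\lambda_2\ge 0$ satisfy $$\lambda_1\,\ell_{d_2}(g)\le \ell_{d_1}(g)\le\lambda_2\,\ell_{d_2}(g)\qquad\text{for all } g\in\mathcal{SC}(G).$$ Then for any points $o_1\in X_1$ and $o_2\in X_2$ there exists $C\ge 0$ such that $$\lambda_1\, d_2(go_2,ho_2)-C\le d_1(go_1,ho_1)\le\lambda_2\, d_2(go_2,ho_2)+C\qquad\text{for all } g,h\in G.$$ -/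

import Mathlib

open Filter Topology
open scoped NNReal

namespace MLS

noncomputable section

/-- The map `α`, restricted to `[0, L]`, is a geodesic segment of length `L`. -/
def IsGeodesicSegment {X : Type*} [MetricSpace X] (α : ℝ → X) (L : ℝ) : Prop :=
  0 ≤ L ∧ ∀ s ∈ Set.Icc (0 : ℝ) L, ∀ t ∈ Set.Icc (0 : ℝ) L, dist (α s) (α t) = |s - t|

/-- Any two points are joined by a geodesic segment. -/
def IsGeodesicSpace (X : Type*) [MetricSpace X] : Prop :=
  ∀ x y : X, ∃ (α : ℝ → X) (L : ℝ), IsGeodesicSegment α L ∧ α 0 = x ∧ α L = y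

/-- The (coarse) closest point projection of the point `x` to the subset `A`. The additive error `1`
makes it nonempty for every nonempty `A`, in spaces that need not be proper. -/
def coarseProj {X : Type*} [MetricSpace X] (A : Set X) (x : X) : Set X :=
  {y | y ∈ A ∧ dist x y ≤ Metric.infDist x A + 1}

/-- `Y` is `C`-contracting: every geodesic segment at distance at least `C` from `Y` has a
projection to `Y` of diameter at most `C`. -/
def IsContractingWith {X : Type*} [MetricSpace X] (C : ℝ) (Y : Set X) : Prop :=
  ∀ (α : ℝ → X) (L : ℝ), IsGeodesicSegment α L →
    (∀ t ∈ Set.Icc (0 : ℝ) L, ∀ y ∈ Y, C ≤ dist (α t) y) →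
      ∀ s ∈ Set.Icc (0 : ℝ) L, ∀ t ∈ Set.Icc (0 : ℝ) L,
        ∀ p ∈ coarseProj Y (α s), ∀ q ∈ coarseProj Y (α t), dist p q ≤ C

/-- `Y` is a contracting subset. -/
def IsContractingSubset {X : Type*} [MetricSpace X] (Y : Set X) : Prop :=
  ∃ C : ℝ, 0 ≤ C ∧ IsContractingWith C Y

/-- The closed `r`-neighbourhoods of `Y` and `Z` intersect in a set of diameter at most `R r`,
for every `r ≥ 0`. -/
def HasBoundedIntersectionWith {X : Type*} [MetricSpace X] (R : ℝ≥0 → ℝ≥0) (Y Z : Set X) : Prop :=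
  ∀ r : ℝ≥0, ∀ x ∈ Metric.cthickening (r : ℝ) Y ∩ Metric.cthickening (r : ℝ) Z,
    ∀ y ∈ Metric.cthickening (r : ℝ) Y ∩ Metric.cthickening (r : ℝ) Z, dist x y ≤ R r

/-- `n ↦ x n` is a quasi-isometric embedding of `ℤ`. -/
def IsQIEmbeddingInt {X : Type*} [MetricSpace X] (x : ℤ → X) : Prop :=
  ∃ lam c : ℝ, 1 ≤ lam ∧ 0 ≤ c ∧ ∀ m n : ℤ,
    1 / lam * |(m : ℝ) - n| - c ≤ dist (x m) (x n) ∧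
      dist (x m) (x n) ≤ lam * |(m : ℝ) - n| + c

/-- The orbit `⟨h⟩ o` of the cyclic group generated by `h`. -/
def cyclicOrbit {G X : Type*} [Group G] [MulAction G X] (o : X) (h : G) : Set X :=
  Set.range fun n : ℤ => h ^ n • o

/-- `h` is a contracting element (the orbit of the basepoint `o` is used). -/
def IsContractingElement {G X : Type*} [Group G] [MetricSpace X] [MulAction G X]
    (o : X) (h : G) : Prop :=
  IsContractingSubset (cyclicOrbit o h) ∧ IsQIEmbeddingInt fun n : ℤ => h ^ n • o

/-- The contracting elements `g` and `h` are weakly independent. -/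
def WeaklyIndependent {G X : Type*} [Group G] [MetricSpace X] [MulAction G X]
    (o : X) (g h : G) : Prop :=
  IsContractingElement o g ∧ IsContractingElement o h ∧
    ∃ R : ℝ≥0 → ℝ≥0, HasBoundedIntersectionWith R (cyclicOrbit o g) (cyclicOrbit o h)

/-- The action of `G` on `X` has contracting property. -/
def HasContractingProperty (G : Type*) {X : Type*} [Group G] [MetricSpace X] [MulAction G X]
    (o : X) : Prop :=
  ∃ g h : G, WeaklyIndependent o g h

/-- The set of simultaneously contracting elements of two actions of `G`. -/
def simultaneouslyContracting (G : Type*) {X₁ X₂ : Type*} [Group G]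
    [MetricSpace X₁] [MulAction G X₁] [MetricSpace X₂] [MulAction G X₂]
    (o₁ : X₁) (o₂ : X₂) : Set G :=
  {g | IsContractingElement o₁ g ∧ IsContractingElement o₂ g}

/-- The stable translation length of `g`, the limit of `d(o, gⁿ o) / n`. -/
def stableLength {G X : Type*} [Group G] [MetricSpace X] [MulAction G X] (o : X) (g : G) : ℝ :=
  limUnder atTop fun n : ℕ => dist o (g ^ n • o) / n

/-- The limit that defines the stable translation length exists. -/
theorem tendsto_stableLength {G X : Type*} [Group G] [MetricSpace X] [MulAction G X]
    [IsIsometricSMul G X] (o : X) (g : G) :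
    Tendsto (fun n : ℕ => dist o (g ^ n • o) / n) atTop (𝓝 (stableLength o g)) := by
  have hsub : Subadditive fun n : ℕ => dist o (g ^ n • o) := by
    intro m n
    calc dist o (g ^ (m + n) • o)
        ≤ dist o (g ^ m • o) + dist (g ^ m • o) (g ^ (m + n) • o) := dist_triangle _ _ _
      _ = dist o (g ^ m • o) + dist o (g ^ n • o) := by
          rw [pow_add, mul_smul, dist_smul]
  have hbdd : BddBelow (Set.range fun n : ℕ => dist o (g ^ n • o) / n) :=
    ⟨0, by rintro _ ⟨n, rfl⟩; positivity⟩
  exact tendsto_nhds_limUnder ⟨_, hsub.tendsto_lim hbdd⟩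

end

end MLS

namespace MLS

/-! Stable length never exceeds displacement, so it suffices to multiply each `g` by one of finitely
many elements to get a `w` that is contracting for both actions and whose two stable lengths are at
least the displacements of `g` minus a constant (`exists_simultaneouslyContracting`). The hypothesis
on `w` then becomes the conclusion for `g`.

For one action, contraction is handled through gates: a nonempty subset of a geodesic space is
contracting exactly when it carries one. Let `a`, `b` be weakly independent. If `h • p` and `h⁻¹ •
p` project far from `p` on the `b`-orbit, they project near `p` on the `a`-orbit
(`IsGate.near_or_near`). For large `n` the translates of the `a`-orbit under powers of `a ^ n * h`
then form a chain of gates, and a local-to-global argument (`IsGateChain`) makes `a ^ n * h`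
contracting. Taking `h = vᵢ g vⱼ⁻¹` with five fixed powers `vᵢ` of `b`, all but at most 10 of the 25
pairs work, whatever `g` is (`HasContractingProperty.exists_family`).

For two actions, `g f₁ f₂` is conjugate to `f₂ g f₁`. So it suffices that `f₁` is a good extension
of `f₂ g` in the first space and `f₂` one of `g f₁` in the second. The two choices depend on each
other, but each excludes fewer than half of the candidates, so double counting yields a compatible
pair. -/

/-- `π` is a coarse projection of `X` onto `Y` such that, as soon as the projections of two points
are far apart, travelling from one point to the other through their projections is, up to a
bounded error, as short as possible. -/
structure IsGate {X : Type*} [MetricSpace X] (κ : ℝ) (Y : Set X) (π : X → X) : Prop where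
  mem : ∀ x, π x ∈ Y
  fix : ∀ y ∈ Y, dist (π y) y ≤ κ
  proj : ∀ x y, dist (π x) (π y) ≤ κ ∨
    dist x (π x) + dist (π x) (π y) + dist (π y) y - κ ≤ dist x y

/-! ### Elementary properties of gates -/

namespace IsGate

variable {X : Type*} [MetricSpace X] {κ : ℝ} {Y : Set X} {π : X → X}

theorem nonneg (h : IsGate κ Y π) (x : X) : 0 ≤ κ :=
  dist_nonneg.trans (h.fix _ (h.mem x))

/-- Since `π y` is close to `y`, both alternatives of `proj` give this bound. It makes `π x` a
coarse nearest point. -/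
theorem dist_add_dist_le (h : IsGate κ Y π) (x : X) {y : X} (hy : y ∈ Y) :
    dist x (π x) + dist (π x) y ≤ dist x y + 4 * κ := by
  have h0 := h.nonneg x
  have h1 := h.fix y hy
  have h2 := dist_triangle (π x) (π y) y
  have h3 := dist_triangle_right x (π x) y
  rcases h.proj x y with h4 | h4 <;> linarith

theorem dist_proj_le_of_near (h : IsGate κ Y π) {x y : X} (hy : y ∈ Y) {r : ℝ}
    (hr : dist x y ≤ Metric.infDist x Y + r) : dist (π x) y ≤ r + 4 * κ := by
  have h1 := h.dist_add_dist_le x hy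
  have h2 := Metric.infDist_le_dist_of_mem (x := x) (h.mem x)
  linarith

/-- A gate is coarsely equivariant under the isometries that preserve the set. -/
theorem dist_proj_smul_le {G : Type*} [Group G] [MulAction G X] [IsIsometricSMul G X]
    (h : IsGate κ Y π) {g : G} (hg : ∀ y ∈ Y, g • y ∈ Y) (hg' : ∀ y ∈ Y, g⁻¹ • y ∈ Y) (x : X) :
    dist (π (g • x)) (g • π x) ≤ 4 * κ := by
  have h1 := h.dist_add_dist_le (g • x) (hg _ (h.mem x))
  have h2 := h.dist_add_dist_le x (hg' _ (h.mem (g • x)))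
  have h3 : dist x (g⁻¹ • π (g • x)) = dist (g • x) (π (g • x)) := by
    rw [← dist_smul g x, smul_inv_smul]
  have h4 : dist (π x) (g⁻¹ • π (g • x)) = dist (π (g • x)) (g • π x) := by
    rw [← dist_smul g (π x), smul_inv_smul, dist_comm]
  rw [h3, h4] at h2
  rw [dist_smul] at h1
  linarith

theorem of_close (h : IsGate κ Y π) {Z : Set X} {D : ℝ} {φ : X → X}
    (hφ : ∀ y ∈ Y, φ y ∈ Z) (hφD : ∀ y ∈ Y, dist (φ y) y ≤ D)
    (hZ : ∀ z ∈ Z, ∃ y ∈ Y, dist z y ≤ D) : IsGate (4 * κ + 4 * D) Z (φ ∘ π) where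
  mem x := hφ _ (h.mem x)
  fix z hz := by
    obtain ⟨y, hy, hyz⟩ := hZ z hz
    have h1 := h.dist_add_dist_le z hy
    have h2 := hφD _ (h.mem z)
    have h3 := dist_triangle_right (φ (π z)) z (π z)
    have h4 : 0 ≤ dist (π z) y := dist_nonneg
    have h5 : 0 ≤ dist z y := dist_nonneg
    simp only [Function.comp_apply]
    linarith
  proj x y := by
    have h0 := h.nonneg x
    have h1 := hφD _ (h.mem x)
    have h2 := hφD _ (h.mem y)
    have h3 := dist_triangle4_right (φ (π x)) (φ (π y)) (π x) (π y)
    have h4 := dist_triangle_right x (φ (π x)) (π x)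
    have h5 := dist_triangle_left (φ (π y)) y (π y)
    have h6 := dist_comm (π y) (φ (π y))
    have h7 : 0 ≤ dist (φ (π x)) (π x) := dist_nonneg
    simp only [Function.comp_apply]
    rcases h.proj x y with h8 | h8
    · left; linarith
    · right; linarith

theorem smul {G : Type*} [Group G] [MulAction G X] [IsIsometricSMul G X]
    (h : IsGate κ Y π) (g : G) :
    IsGate κ ((fun y => g • y) '' Y) fun x => g • π (g⁻¹ • x) where
  mem x := ⟨_, h.mem _, rfl⟩
  fix := by
    rintro _ ⟨y, hy, rfl⟩
    simpa using h.fix y hy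
  proj x y := by
    have h1 := h.proj (g⁻¹ • x) (g⁻¹ • y)
    have key : ∀ u v : X, dist (g⁻¹ • u) v = dist u (g • v) := fun u v => by
      rw [← dist_smul g, smul_inv_smul]
    rw [key x, dist_comm _ (g⁻¹ • y), key y, dist_smul] at h1
    rwa [dist_smul, dist_comm _ y]

end IsGate

/-! ### Contracting sets and gates -/

section Contracting

variable {X : Type*} [MetricSpace X] {Y : Set X}

theorem coarseProj_nonempty (hY : Y.Nonempty) (x : X) : (coarseProj Y x).Nonempty := by
  obtain ⟨y, hy, h⟩ := (Metric.infDist_lt_iff hY).1 (lt_add_one (Metric.infDist x Y))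
  exact ⟨y, hy, h.le⟩

theorem IsGeodesicSegment.mono {α : ℝ → X} {L M : ℝ} (h : IsGeodesicSegment α L) (hM : 0 ≤ M)
    (hML : M ≤ L) : IsGeodesicSegment α M :=
  ⟨hM, fun s hs t ht => h.2 s ⟨hs.1, hs.2.trans hML⟩ t ⟨ht.1, ht.2.trans hML⟩⟩

theorem IsGeodesicSegment.reverse {α : ℝ → X} {L : ℝ} (h : IsGeodesicSegment α L) :
    IsGeodesicSegment (fun t => α (L - t)) L := by
  refine ⟨h.1, fun s hs t ht => ?_⟩
  rw [h.2 _ ⟨by linarith [hs.2], by linarith [hs.1]⟩ _ ⟨by linarith [ht.2], by linarith [ht.1]⟩,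
    abs_sub_comm]
  congr 1; ring

/-- A geodesic segment that comes close to a contracting set passes, before doing so, near every
projection of its starting point. -/
theorem IsContractingWith.exists_near_proj {C : ℝ} (hC : 0 ≤ C) (hY : Y.Nonempty)
    (h : IsContractingWith C Y) {α : ℝ → X} {L : ℝ} (hα : IsGeodesicSegment α L)
    {t : ℝ} (ht : t ∈ Set.Icc 0 L) (htY : Metric.infDist (α t) Y < C)
    {p : X} (hp : p ∈ coarseProj Y (α 0)) :
    ∃ s ∈ Set.Icc 0 L, (∀ u ∈ Set.Icc 0 L, Metric.infDist (α u) Y < C → s ≤ u) ∧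
      dist (α s) p ≤ 2 * C + 3 := by
  set T : Set ℝ := {u | u ∈ Set.Icc 0 L ∧ Metric.infDist (α u) Y < C} with hT
  have hTne : T.Nonempty := ⟨t, ht, htY⟩
  have hTb : BddBelow T := ⟨0, fun u hu => hu.1.1⟩
  have hI0 : 0 ≤ sInf T := le_csInf hTne fun u hu => hu.1.1
  obtain ⟨u, hu, hu'⟩ := exists_lt_of_csInf_lt hTne (lt_add_one (sInf T))
  have hIu : sInf T ≤ u := csInf_le hTb hu
  have hsI : max (sInf T - 1) 0 ≤ sInf T := max_le (by linarith) hI0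
  -- Stepping back by one from the infimum keeps `[0, s]` out of `T`, so contraction applies there.
  -- If truncation gives `s = 0`, then `p` is itself a projection of `α s`.
  set s := max (sInf T - 1) 0 with hs
  have hs0 : 0 ≤ s := le_max_right _ _
  have hs1 : sInf T - 1 ≤ s := le_max_left _ _
  have hsL : s ∈ Set.Icc 0 L := ⟨hs0, hsI.trans (hIu.trans hu.1.2)⟩
  refine ⟨s, hsL, fun v hv hv' => hsI.trans (csInf_le hTb ⟨hv, hv'⟩), ?_⟩
  have hd : dist (α s) (α u) ≤ 2 := by
    rw [hα.2 s hsL u hu.1, abs_le]; constructor <;> linarith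
  obtain ⟨q, hqY, hq, hpq⟩ : ∃ q, q ∈ Y ∧ dist (α s) q ≤ Metric.infDist (α s) Y + 1 ∧
      dist p q ≤ C := by
    rcases eq_or_lt_of_le hs0 with h0 | h0
    · exact ⟨p, hp.1, by rw [← h0]; exact hp.2, by simpa using hC⟩
    · have hsI' : s = sInf T - 1 := by
        rcases max_choice (sInf T - 1) 0 with h1 | h1
        · exact h1
        · exact absurd h1 h0.ne'
      obtain ⟨q, hq⟩ := coarseProj_nonempty hY (α s)
      refine ⟨q, hq.1, hq.2, h α s (hα.mono hs0 hsL.2) (fun v hv y hy => ?_) 0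
        ⟨le_rfl, hs0⟩ s ⟨hs0, le_rfl⟩ p hp q hq⟩
      by_contra! hlt
      have : sInf T ≤ v := csInf_le hTb ⟨⟨hv.1, hv.2.trans hsL.2⟩,
        (Metric.infDist_le_dist_of_mem hy).trans_lt hlt⟩
      linarith [hv.2]
  have h1 : Metric.infDist (α s) Y ≤ Metric.infDist (α u) Y + dist (α s) (α u) :=
    Metric.infDist_le_infDist_add_dist
  have h2 := dist_triangle_right (α s) p q
  linarith [hu.2]

/-- In a geodesic space the projection to a contracting set is a gate. -/
theorem IsContractingSubset.exists_isGate (hX : IsGeodesicSpace X) (hY : Y.Nonempty)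
    (h : IsContractingSubset Y) : ∃ κ π, IsGate κ Y π := by
  obtain ⟨C, hC, h⟩ := h
  choose π hπ using coarseProj_nonempty (X := X) hY
  -- Four times the error `2 * C + 3` of `exists_near_proj`: each of the two projections is compared
  -- twice with a nearby point of the segment.
  refine ⟨8 * C + 12, π, fun x => (hπ x).1, fun y hy => ?_, fun x y => ?_⟩
  · have := (hπ y).2
    rw [Metric.infDist_zero_of_mem hy, dist_comm] at this
    linarith
  · by_cases hxy : dist (π x) (π y) ≤ C
    · left; linarith
    right
    obtain ⟨α, L, hα, rfl, rfl⟩ := hX x y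
    have h0 : (0 : ℝ) ∈ Set.Icc 0 L := ⟨le_rfl, hα.1⟩
    have hL : L ∈ Set.Icc 0 L := ⟨hα.1, le_rfl⟩
    obtain ⟨t, ht, htY⟩ : ∃ t ∈ Set.Icc 0 L, Metric.infDist (α t) Y < C := by
      by_contra! hcon
      exact hxy (h α L hα (fun t ht y hy => (hcon t ht).trans (Metric.infDist_le_dist_of_mem hy))
        0 h0 L hL _ (hπ _) _ (hπ _))
    obtain ⟨s, hs, hsmin, hsd⟩ := h.exists_near_proj hC hY hα ht htY (hπ _)
    obtain ⟨s', hs', hsmin', hsd'⟩ := h.exists_near_proj hC hY hα.reverse (t := L - t)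
      (p := π (α L)) ⟨by linarith [ht.2], by linarith [ht.1]⟩ (by simpa using htY)
      (by simpa using hπ (α L))
    -- Minimality at both ends gives `s ≤ t ≤ L - s'`, so the segment meets the two projections in
    -- the right order.
    have h1 := hsmin t ht htY
    have h2 := hsmin' (L - t) ⟨by linarith [ht.2], by linarith [ht.1]⟩ (by simpa using htY)
    have hs'' : L - s' ∈ Set.Icc 0 L := ⟨by linarith [hs'.2], by linarith [hs'.1]⟩
    have d1 : dist (α 0) (α s) = s := by
      rw [hα.2 0 h0 s hs, zero_sub, abs_neg, abs_of_nonneg hs.1]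
    have d2 : dist (α s) (α (L - s')) = L - s' - s := by
      rw [hα.2 s hs _ hs'', abs_sub_comm, abs_of_nonneg (by linarith)]
    have d3 : dist (α (L - s')) (α L) = s' := by
      rw [hα.2 _ hs'' L hL, abs_sub_comm, abs_of_nonneg (by linarith [hs'.1])]; ring
    have d4 : dist (α 0) (α L) = L := by
      rw [hα.2 0 h0 L hL, zero_sub, abs_neg, abs_of_nonneg hα.1]
    have e1 := dist_triangle (α 0) (α s) (π (α 0))
    have e2 := dist_triangle4_left (α s) (α (L - s')) (π (α 0)) (π (α L))
    have e3 := dist_triangle_left (π (α L)) (α L) (α (L - s'))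
    linarith

/-- A set in a geodesic space that carries a gate is contracting. -/
theorem IsGate.isContractingSubset {κ : ℝ} {π : X → X} (h : IsGate κ Y π) :
    IsContractingSubset Y := by
  by_cases hne : Nonempty X
  swap
  · exact ⟨0, le_rfl, fun α => (hne ⟨α 0⟩).elim⟩
  have h0 : 0 ≤ κ := h.nonneg hne.some
  -- This is `3 * κ + 2 * (4 * κ + 1)`: the drift of `π` along `α`, plus the error of comparing `π`
  -- with `coarseProj` at each end.
  refine ⟨11 * κ + 2, by linarith, fun α L hα hfar s hs t ht p hp q hq => ?_⟩
  have hfar' : ∀ t ∈ Set.Icc 0 L, 11 * κ + 2 ≤ dist (α t) (π (α t)) := fun t ht =>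
    hfar t ht _ (h.mem _)
  have hjump : ∀ u ∈ Set.Icc 0 L, ∀ v ∈ Set.Icc 0 L, |u - v| ≤ 1 →
      dist (π (α u)) (π (α v)) ≤ κ := by
    intro u hu v hv huv
    rcases h.proj (α u) (α v) with h1 | h1
    · exact h1
    · have h2 := hfar' u hu
      have h3 := hfar' v hv
      rw [hα.2 u hu v hv, dist_comm _ (α v)] at h1
      have : 0 ≤ dist (π (α u)) (π (α v)) := dist_nonneg
      linarith
  have key : ∀ s ∈ Set.Icc 0 L, ∀ t ∈ Set.Icc 0 L, s ≤ t →
      dist (π (α s)) (π (α t)) ≤ 3 * κ := by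
    intro s hs t ht hst
    -- A discrete intermediate value argument: unit time steps move the projection by at most `κ`,
    -- so a drift beyond `κ` is first seen at a value of at most `2 * κ`.
    have hgrid : ∀ n : ℕ, ∀ u ∈ Set.Icc s t, u ≤ s + n → dist (π (α s)) (π (α u)) ≤ κ ∨
        ∃ v ∈ Set.Icc s u, κ < dist (π (α s)) (π (α v)) ∧
          dist (π (α s)) (π (α v)) ≤ 2 * κ := by
      intro n
      induction n with
      | zero =>
        intro u hu hun
        have : u = s := le_antisymm (by simpa using hun) hu.1
        left; rw [this]; simpa using h0
      | succ n ih =>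
        intro u hu hun
        push_cast at hun
        have hmI : max (u - 1) s ∈ Set.Icc s t :=
          ⟨le_max_right _ _, max_le (by linarith [hu.2]) hst⟩
        have hmu : max (u - 1) s ≤ u := max_le (by linarith) hu.1
        have hm1 : u - 1 ≤ max (u - 1) s := le_max_left _ _
        rcases ih (max (u - 1) s) hmI
          (max_le (by linarith) (by linarith [Nat.cast_nonneg (α := ℝ) n])) with h1 | h1
        · by_cases h2 : dist (π (α s)) (π (α u)) ≤ κ
          · exact Or.inl h2
          · refine Or.inr ⟨u, ⟨hu.1, le_rfl⟩, not_le.1 h2, ?_⟩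
            have h3 := hjump (max (u - 1) s) ⟨hs.1.trans hmI.1, hmI.2.trans ht.2⟩ u
              ⟨hs.1.trans hu.1, hu.2.trans ht.2⟩ (by rw [abs_le]; constructor <;> linarith)
            linarith [dist_triangle (π (α s)) (π (α (max (u - 1) s))) (π (α u))]
        · obtain ⟨v, hv, hv'⟩ := h1
          exact Or.inr ⟨v, ⟨hv.1, hv.2.trans hmu⟩, hv'⟩
    obtain ⟨n, hn⟩ := exists_nat_ge (t - s)
    rcases hgrid n t ⟨hst, le_rfl⟩ (by linarith) with h1 | ⟨v, hv, hv1, hv2⟩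
    · linarith
    have hvL : v ∈ Set.Icc 0 L := ⟨hs.1.trans hv.1, hv.2.trans ht.2⟩
    have d1 := hα.2 s hs v hvL
    have d2 := hα.2 v hvL t ht
    have d3 := hα.2 s hs t ht
    rw [abs_sub_comm, abs_of_nonneg (by linarith [hv.1])] at d1
    rw [abs_sub_comm, abs_of_nonneg (by linarith [hv.2])] at d2
    rw [abs_sub_comm, abs_of_nonneg (by linarith)] at d3
    have e1 := (h.proj (α s) (α v)).resolve_left (not_le.2 hv1)
    have f1 := hfar' v hvL
    have f2 := dist_comm (α v) (π (α v))
    rcases h.proj (α v) (α t) with h2 | h2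
    · linarith [dist_triangle (π (α s)) (π (α v)) (π (α t))]
    -- Both halves of the segment would travel through `π (α v)`, so the excursion to `α v`, far
    -- from `Y`, would be a detour too long for a geodesic.
    · exfalso
      have g1 := dist_triangle4 (α s) (π (α s)) (π (α v)) (π (α t))
      have g2 := dist_triangle (α s) (π (α t)) (α t)
      linarith
  have hp' := h.dist_proj_le_of_near hp.1 hp.2
  have hq' := h.dist_proj_le_of_near hq.1 hq.2
  have hst : dist (π (α s)) (π (α t)) ≤ 3 * κ := by
    rcases le_total s t with h1 | h1
    · exact key s hs t ht h1
    · rw [dist_comm]; exact key t ht s hs h1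
  linarith [dist_triangle4_left (π (α s)) (π (α t)) p q]

end Contracting

/-! ### Chains of gates: from local to global -/

/-- A bi-infinite sequence of coarse projections `π i`, together with points `e i` and `f i` at
which a path enters and leaves the image of `π i`. The path goes far along each of the images, and
the passage from one image to the next projects to a bounded set. -/
structure IsGateChain {X : Type*} [MetricSpace X] (κ : ℝ) (π : ℤ → X → X) (e f : ℤ → X) :
    Prop where
  proj : ∀ i x y, dist (π i x) (π i y) ≤ κ ∨
    dist x (π i x) + dist (π i x) (π i y) + dist (π i y) y - κ ≤ dist x y
  entry : ∀ i, dist (π i (e i)) (e i) ≤ κ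
  exit : ∀ i, dist (π i (e (i + 1))) (f i) ≤ κ
  next : ∀ i, dist (π (i + 1) (f i)) (e (i + 1)) ≤ κ
  gap : ∀ i, 3 * κ < dist (f i) (e (i + 1))
  long : ∀ i, 9 * κ + 1 ≤ dist (e i) (f i)

namespace IsGateChain

variable {X : Type*} [MetricSpace X] {κ : ℝ} {π : ℤ → X → X} {e f : ℤ → X}

theorem nonneg (h : IsGateChain κ π e f) : 0 ≤ κ := dist_nonneg.trans (h.entry 0)

/-- A Behrstock-type inequality. If both fail, going from `x` to `e (i + 1)` passes near `f i`, and
going from `x` to `f i` passes near `e (i + 1)`. Adding the two estimates bounds the gap by `3 * κ`.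
-/
theorem right_or_left_succ (h : IsGateChain κ π e f) (i : ℤ) (x : X) :
    dist (π i x) (f i) ≤ 2 * κ ∨ dist (π (i + 1) x) (e (i + 1)) ≤ 2 * κ := by
  by_contra! hcon
  obtain ⟨h1, h2⟩ := hcon
  have a1 := h.exit i
  have a2 := h.next i
  have a3 := h.gap i
  have b1 := dist_triangle (π i x) (π i (e (i + 1))) (f i)
  have b2 := dist_triangle (π (i + 1) x) (π (i + 1) (f i)) (e (i + 1))
  have c1 := (h.proj i x (e (i + 1))).resolve_left (by linarith)
  have c2 := (h.proj (i + 1) x (f i)).resolve_left (by linarith)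
  have d1 := dist_triangle4 x (π i x) (π i (e (i + 1))) (f i)
  have d2 := dist_triangle4 x (π (i + 1) x) (π (i + 1) (f i)) (e (i + 1))
  have d3 := dist_triangle_left (f i) (e (i + 1)) (π i (e (i + 1)))
  have d4 := dist_triangle_left (e (i + 1)) (f i) (π (i + 1) (f i))
  have d5 := dist_comm (f i) (e (i + 1))
  linarith

theorem not_right_of_left (h : IsGateChain κ π e f) {i : ℤ} {x : X}
    (hx : dist (π i x) (e i) ≤ 2 * κ) : ¬ dist (π i x) (f i) ≤ 2 * κ := fun hx' => by
  linarith [h.long i, dist_triangle_left (e i) (f i) (π i x), h.nonneg]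

/-- Being near `e i` excludes being near `f i`, as these are far apart, so the Behrstock alternative
pushes the property to the next index. -/
theorem left_of_le (h : IsGateChain κ π e f) {i j : ℤ} (hij : i ≤ j) {x : X}
    (hx : dist (π i x) (e i) ≤ 2 * κ) : dist (π j x) (e j) ≤ 2 * κ := by
  induction j, hij using Int.leInduction with
  | base => exact hx
  | succ j _ ih => exact (h.right_or_left_succ j x).resolve_left (h.not_right_of_left ih)

theorem left_of_lt (h : IsGateChain κ π e f) {i j : ℤ} (hij : i < j) {x : X}
    (hx : ¬ dist (π i x) (f i) ≤ 2 * κ) : dist (π j x) (e j) ≤ 2 * κ :=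
  h.left_of_le (Int.add_one_le_iff.2 hij) ((h.right_or_left_succ i x).resolve_left hx)

theorem right_of_le (h : IsGateChain κ π e f) {i j : ℤ} (hij : i ≤ j) {x : X}
    (hx : dist (π j x) (f j) ≤ 2 * κ) : dist (π i x) (f i) ≤ 2 * κ := by
  rcases hij.eq_or_lt with rfl | hlt
  · exact hx
  · by_contra hcon
    exact h.not_right_of_left (h.left_of_lt hlt hcon) hx

theorem left_entry (h : IsGateChain κ π e f) {i j : ℤ} (hij : i ≤ j) :
    dist (π j (e i)) (e j) ≤ 2 * κ :=
  h.left_of_le hij (by linarith [h.entry i, h.nonneg])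

theorem right_entry (h : IsGateChain κ π e f) {i j : ℤ} (hij : j < i) :
    dist (π j (e i)) (f j) ≤ 2 * κ := by
  have h1 := h.exit (i - 1)
  rw [sub_add_cancel] at h1
  exact h.right_of_le (Int.le_sub_one_of_lt hij) (by linarith [h.nonneg])

theorem le_dist (h : IsGateChain κ π e f) {i : ℤ} {x y : X} (hx : dist (π i x) (e i) ≤ 2 * κ)
    (hy : dist (π i y) (f i) ≤ 2 * κ) :
    dist x (e i) + dist (e i) (f i) + dist (f i) y - 9 * κ ≤ dist x y := by
  have h0 := h.nonneg
  have h1 := dist_triangle4_left (π i x) (π i y) (e i) (f i)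
  have h2 := h.long i
  have h3 := (h.proj i x y).resolve_left (by linarith)
  have h4 := dist_triangle x (π i x) (e i)
  have h5 := dist_triangle_left (f i) y (π i y)
  linarith

theorem le_dist_through_entry (h : IsGateChain κ π e f) {i : ℤ} {x y : X}
    (hx : dist (π i x) (e i) ≤ 2 * κ) (hy : dist (π i y) (f i) ≤ 2 * κ) :
    dist x (e i) + dist (e i) y - 9 * κ ≤ dist x y := by
  linarith [h.le_dist hx hy, dist_triangle (e i) (f i) y]

/-- The loss `9 * κ` in `le_dist` is paid by `long`, which leaves a net gain of `1` plus the gap at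
every link. -/
theorem mul_le_dist (h : IsGateChain κ π e f) {δ : ℝ} (hδ : ∀ i, δ ≤ dist (f i) (e (i + 1)))
    (i : ℤ) (n : ℕ) : n * (δ + 1) ≤ dist (e i) (e (i + n)) := by
  induction n with
  | zero => simp
  | succ n ih =>
    have h1 := h.le_dist (h.left_entry (i := i) (j := i + n) (by omega))
      (h.right_entry (i := i + n + 1) (j := i + n) (by omega))
    have h2 := h.long (i + n)
    have h3 := hδ (i + n)
    push_cast
    rw [← add_assoc]
    linarith

theorem abs_sub_le_dist (h : IsGateChain κ π e f) (i j : ℤ) :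
    |(i : ℝ) - j| ≤ dist (e i) (e j) := by
  wlog hij : i ≤ j generalizing i j
  · rw [abs_sub_comm, dist_comm]; exact this j i (by omega)
  obtain ⟨n, rfl⟩ := Int.le.dest hij
  have := h.mul_le_dist (δ := 0) (fun _ => dist_nonneg) i n
  push_cast
  rw [sub_add_cancel_left, abs_neg, abs_of_nonneg (Nat.cast_nonneg n)]
  linarith

/-- Every point lies to the right of an initial part of the chain and to the left of a final
part. -/
theorem exists_index (h : IsGateChain κ π e f) (x : X) :
    ∃ k : ℤ, (∀ i < k, dist (π i x) (f i) ≤ 2 * κ) ∧ ¬ dist (π k x) (f k) ≤ 2 * κ := by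
  obtain ⟨n, hn⟩ := exists_nat_gt (dist x (e 0) + 9 * κ)
  have hbelow : ∀ i : ℤ, ¬ dist (π i x) (f i) ≤ 2 * κ → -(n : ℤ) ≤ i := by
    intro i hi
    by_contra! hlt
    have hn0 : (0 : ℝ) < n := by linarith [dist_nonneg (x := x) (y := e 0), h.nonneg]
    have hn0' : 0 < n := by exact_mod_cast hn0
    have h1 := h.le_dist_through_entry (h.left_of_lt hlt hi)
      (h.right_entry (i := 0) (j := -n) (by omega))
    have h2 := h.abs_sub_le_dist (-n) 0
    have h3 : (n : ℝ) ≤ dist (e (-n)) (e 0) := by simpa using h2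
    linarith [dist_nonneg (x := x) (y := e (-n))]
  have hne : ¬ dist (π n x) (f n) ≤ 2 * κ := by
    intro hR
    have h1 := h.le_dist_through_entry (h.left_entry (i := 0) (j := n) (by omega)) hR
    have h2 := h.abs_sub_le_dist 0 n
    have h3 : (n : ℝ) ≤ dist (e 0) (e n) := by simpa using h2
    linarith [dist_nonneg (x := e n) (y := x), dist_comm x (e 0)]
  obtain ⟨k, hk, hmin⟩ := Int.exists_least_of_bdd ⟨_, hbelow⟩ ⟨_, hne⟩
  exact ⟨k, fun i hi => by_contra fun hcon => absurd (hmin i hcon) (by omega), hk⟩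

/-- The sequence of entry points of a chain carries a gate. -/
theorem exists_isGate (h : IsGateChain κ π e f) {s : ℝ} (hs : ∀ i, dist (e i) (e (i + 1)) ≤ s) :
    ∃ κ' π', IsGate κ' (Set.range e) π' := by
  choose k hk hk' using h.exists_index
  have h0 := h.nonneg
  have hs0 : 0 ≤ s := dist_nonneg.trans (hs 0)
  -- At the index `k x` itself `x` may be on neither side, so the path is routed through `e (k x +
  -- 1)` and `e (k y - 1)`. Each costs `9 * κ`, and returning to `e (k x)` and `e (k y)` costs `4 *
  -- s`.
  have main : ∀ x y, k x ≤ k y → dist (e (k x)) (e (k y)) ≤ 18 * κ + 4 * s ∨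
      dist x (e (k x)) + dist (e (k x)) (e (k y)) + dist (e (k y)) y - (18 * κ + 4 * s) ≤
        dist x y := by
    intro x y hxy
    rcases (by omega : k y = k x ∨ k y = k x + 1 ∨ k x + 1 ≤ k y - 1) with h1 | h1 | h1
    · left; rw [h1, dist_self]; positivity
    · left; rw [h1]; linarith [hs (k x)]
    · right
      have a1 := h.le_dist_through_entry (h.left_of_lt (lt_add_one (k x)) (hk' x))
        (hk y (k x + 1) (by omega))
      have a2 := h.le_dist_through_entry (h.left_entry h1) (hk y (k y - 1) (by omega))
      have b1 := hs (k x)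
      have b2 := hs (k y - 1)
      rw [sub_add_cancel] at b2
      have c1 := dist_triangle_right x (e (k x)) (e (k x + 1))
      have c2 := dist_triangle4 (e (k x)) (e (k x + 1)) (e (k y - 1)) (e (k y))
      have c3 := dist_triangle_left (e (k y)) y (e (k y - 1))
      linarith
  refine ⟨18 * κ + 4 * s, fun x => e (k x), fun x => ⟨_, rfl⟩, ?_, fun x y => ?_⟩
  · rintro _ ⟨j, rfl⟩
    have : k (e j) = j := by
      rcases lt_trichotomy (k (e j)) j with h1 | h1 | h1
      · exact absurd (h.right_entry h1) (hk' _)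
      · exact h1
      · exact absurd (hk _ _ h1) (h.not_right_of_left (h.left_entry le_rfl))
    simp only [this, dist_self]
    positivity
  · rcases le_total (k x) (k y) with h1 | h1
    · exact main x y h1
    · rcases main y x h1 with h2 | h2
      · left; rwa [dist_comm]
      · right
        linarith [dist_comm x y, dist_comm y (e (k y)), dist_comm x (e (k x)),
          dist_comm (e (k x)) (e (k y))]

end IsGateChain

/-! ### Weak independence in terms of gates -/

/-- Two sets with bounded intersection that carry gates: no point projects far from the common
base point on both of them. -/
theorem IsGate.near_or_near {X : Type*} [MetricSpace X] (hX : IsGeodesicSpace X) {κ κ' : ℝ} {A B : Set X} {π π' : X → X}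
    (hA : IsGate κ A π) (hB : IsGate κ' B π') {R : ℝ≥0 → ℝ≥0}
    (hR : HasBoundedIntersectionWith R A B) {p : X} (hpA : p ∈ A) (hpB : p ∈ B) :
    ∃ τ : ℝ, ∀ x, dist (π x) p ≤ τ ∨ dist (π' x) p ≤ τ := by
  -- A geodesic from `p` follows `A` for as long as its endpoint's projection is far from `p`. Two
  -- far projections thus force a long common stretch of the two neighbourhoods.
  have near : ∀ {κ : ℝ} {A : Set X} {π : X → X}, IsGate κ A π → p ∈ A → ∀ {α : ℝ → X} {L : ℝ},
      IsGeodesicSegment α L → α 0 = p → ∀ t ∈ Set.Icc 0 L, t ≤ dist (π (α L)) p →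
        dist (α t) (π (α t)) ≤ 5 * κ := by
    intro κ A π h hp α L hα h0 t ht htp
    have d1 := hα.2 0 ⟨le_rfl, hα.1⟩ t ht
    have d2 := hα.2 t ht L ⟨hα.1, le_rfl⟩
    have d3 := hα.2 0 ⟨le_rfl, hα.1⟩ L ⟨hα.1, le_rfl⟩
    rw [zero_sub, abs_neg, abs_of_nonneg ht.1, h0, dist_comm] at d1
    rw [abs_sub_comm, abs_of_nonneg (by linarith [ht.2])] at d2
    rw [zero_sub, abs_neg, abs_of_nonneg hα.1, h0] at d3
    have e1 := h.dist_add_dist_le (α t) hp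
    have hκ := h.nonneg p
    rcases h.proj (α t) (α L) with h1 | h1
    · have := dist_triangle_left (π (α L)) p (π (α t))
      linarith
    · have g1 := dist_triangle_left p (α L) (π (α t))
      have g2 := dist_triangle (π (α t)) (π (α L)) (α L)
      have : 0 ≤ dist (α t) (π (α t)) := dist_nonneg
      linarith
  have hκ := hA.nonneg p
  have hκ' := hB.nonneg p
  set r : ℝ≥0 := ⟨5 * (κ + κ'), by positivity⟩ with hr
  refine ⟨R r + 4 * κ, fun x => ?_⟩
  by_contra! hcon
  obtain ⟨α, L, hα, h0, rfl⟩ := hX p x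
  have hdL : dist (α L) p = L := by
    rw [← h0, hα.2 L ⟨hα.1, le_rfl⟩ 0 ⟨le_rfl, hα.1⟩, sub_zero, abs_of_nonneg hα.1]
  have hRL : (R r : ℝ) < L := by
    linarith [hA.dist_add_dist_le (α L) hpA, dist_nonneg (x := α L) (y := π (α L))]
  obtain ⟨t, ht1, ht2⟩ := exists_between
    (lt_min hRL (lt_min (b := dist (π (α L)) p) (c := dist (π' (α L)) p)
      (by linarith) (by linarith)))
  obtain ⟨htL, ht2⟩ := lt_min_iff.1 ht2
  obtain ⟨htA, htB⟩ := lt_min_iff.1 ht2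
  have ht : t ∈ Set.Icc 0 L := ⟨(NNReal.coe_nonneg _).trans ht1.le, htL.le⟩
  have hrA : dist (α t) (π (α t)) ≤ r := (near hA hpA hα h0 t ht htA.le).trans (by
    change 5 * κ ≤ 5 * (κ + κ'); linarith)
  have hrB : dist (α t) (π' (α t)) ≤ r := (near hB hpB hα h0 t ht htB.le).trans (by
    change 5 * κ' ≤ 5 * (κ + κ'); linarith)
  have hd := hR r (α t)
    ⟨Metric.mem_cthickening_of_dist_le _ _ _ _ (hA.mem _) hrA,
      Metric.mem_cthickening_of_dist_le _ _ _ _ (hB.mem _) hrB⟩ p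
    ⟨Metric.self_subset_cthickening _ hpA, Metric.self_subset_cthickening _ hpB⟩
  rw [← h0, hα.2 t ht 0 ⟨le_rfl, hα.1⟩, sub_zero, abs_of_nonneg ht.1] at hd
  linarith

/-! ### Stable length and conjugation -/

section Conjugation

variable {G X : Type*} [Group G] [MetricSpace X] [MulAction G X] [IsIsometricSMul G X]

theorem dist_conj_zpow_smul_le (p : X) (k g : G) (n : ℤ) :
    dist ((k * g * k⁻¹) ^ n • p) (k • g ^ n • p) ≤ dist (k⁻¹ • p) p := by
  rw [conj_zpow, mul_smul, mul_smul, dist_smul, dist_smul]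

theorem stableLength_le_dist (p : X) (g : G) : stableLength p g ≤ dist p (g • p) := by
  refine le_of_tendsto (tendsto_stableLength p g) (Eventually.of_forall fun n => ?_)
  refine div_le_of_le_mul₀ (Nat.cast_nonneg n) dist_nonneg ?_
  induction n with
  | zero => simp
  | succ n ih =>
    have h1 := dist_triangle p (g ^ n • p) (g ^ (n + 1) • p)
    rw [pow_succ, mul_smul, dist_smul] at h1
    push_cast
    rw [pow_succ, mul_smul]
    linarith

theorem le_stableLength {p : X} {g : G} {r : ℝ} {c : ℝ}
    (h : ∀ n : ℕ, n * r - c ≤ dist p (g ^ n • p)) : r ≤ stableLength p g := by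
  have h1 : Tendsto (fun n : ℕ => r - c / n) atTop (𝓝 (r - 0)) :=
    tendsto_const_nhds.sub (tendsto_const_div_atTop_nhds_zero_nat c)
  rw [sub_zero] at h1
  refine le_of_tendsto_of_tendsto h1 (tendsto_stableLength p g) ?_
  filter_upwards [eventually_gt_atTop 0] with n hn
  have hn' : (0 : ℝ) < n := by exact_mod_cast hn
  rw [le_div_iff₀ hn', sub_mul, div_mul_cancel₀ _ hn'.ne']
  linarith [h n, mul_comm r (n : ℝ)]

theorem IsQIEmbeddingInt.of_close {x y : ℤ → X} {D : ℝ} (h : IsQIEmbeddingInt x)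
    (hD : ∀ n, dist (y n) (x n) ≤ D) : IsQIEmbeddingInt y := by
  obtain ⟨lam, c, hlam, hc, hx⟩ := h
  have hD0 : 0 ≤ D := dist_nonneg.trans (hD 0)
  refine ⟨lam, c + 2 * D, hlam, by positivity, fun m n => ?_⟩
  obtain ⟨h1, h2⟩ := hx m n
  have h3 := dist_triangle4_left (y m) (y n) (x m) (x n)
  have h4 := dist_triangle4_right (y m) (y n) (x m) (x n)
  constructor <;> linarith [hD m, hD n]

/-- The conjugates of a group element whose orbit is an undistorted gate are contracting. -/
theorem isContractingElement_conj {κ : ℝ} {π : X → X} {p : X} {g : G}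
    (h : IsGate κ (cyclicOrbit p g) π) (hqi : IsQIEmbeddingInt fun n : ℤ => g ^ n • p) (k : G) :
    IsContractingElement p (k * g * k⁻¹) := by
  have hclose := dist_conj_zpow_smul_le p k g
  have hgate := h.smul k
  refine ⟨?_, IsQIEmbeddingInt.of_close (x := fun n : ℤ => k • g ^ n • p) ?_ hclose⟩
  · have hex : ∀ y : X, ∃ z : X, y ∈ (fun y => k • y) '' cyclicOrbit p g →
        z ∈ cyclicOrbit p (k * g * k⁻¹) ∧ dist z y ≤ dist (k⁻¹ • p) p := by
      intro y
      by_cases hy : y ∈ (fun y => k • y) '' cyclicOrbit p g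
      · obtain ⟨_, ⟨n, rfl⟩, rfl⟩ := hy
        exact ⟨_, fun _ => ⟨⟨n, rfl⟩, hclose n⟩⟩
      · exact ⟨y, fun hy' => absurd hy' hy⟩
    choose φ hφ using hex
    refine (hgate.of_close (fun y hy => (hφ y hy).1) (fun y hy => (hφ y hy).2)
      ?_).isContractingSubset
    rintro _ ⟨n, rfl⟩
    exact ⟨_, ⟨_, ⟨n, rfl⟩, rfl⟩, hclose n⟩
  · simpa only [IsQIEmbeddingInt, dist_smul] using hqi

end Conjugation

/-! ### Orbits of cyclic groups and their translates -/

section Orbit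

variable {G X : Type*} [Group G] [MulAction G X]

theorem zpow_smul_mem_cyclicOrbit {p : X} (g : G) (n : ℤ) {y : X} (hy : y ∈ cyclicOrbit p g) :
    g ^ n • y ∈ cyclicOrbit p g := by
  obtain ⟨m, rfl⟩ := hy
  exact ⟨n + m, by simp only [zpow_add, mul_smul]⟩

theorem mem_cyclicOrbit (p : X) (g : G) : p ∈ cyclicOrbit p g := ⟨0, by simp⟩

variable [MetricSpace X]

theorem exists_lt_dist_zpow {p : X} {g : G} (h : IsQIEmbeddingInt fun n : ℤ => g ^ n • p)
    (r : ℝ) : ∃ N : ℕ, ∀ m n : ℤ, (N : ℤ) ≤ |m - n| → r < dist (g ^ m • p) (g ^ n • p) := by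
  obtain ⟨lam, c, hlam, hc, hx⟩ := h
  have hlam0 : 0 < lam := by linarith
  obtain ⟨N, hN⟩ := exists_nat_gt (lam * (r + c))
  refine ⟨N, fun m n hmn => ?_⟩
  have h1 := (hx m n).1
  have h2 : (N : ℝ) ≤ |(m : ℝ) - n| := by exact_mod_cast hmn
  have h3 : r + c < 1 / lam * |(m : ℝ) - n| := by
    rw [one_div, ← div_eq_inv_mul, lt_div_iff₀ hlam0]
    linarith [mul_comm lam (r + c)]
  linarith

variable [IsIsometricSMul G X]

theorem dist_zpow_smul_zpow_smul (p : X) (g : G) (m n : ℤ) :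
    dist (g ^ m • p) (g ^ n • p) = dist p (g ^ (n - m) • p) := by
  rw [← dist_smul (g ^ m) p, ← mul_smul, ← zpow_add, add_sub_cancel]

/-- The chain formed by the translates of a gate under the powers of `t * h`, where `t` preserves
the gate and `h` leaves it in directions that project near the base point. -/
theorem IsGate.isGateChain {κ τ K : ℝ} {A : Set X} {π : X → X} (hA : IsGate κ A π) {p : X}
    (hp : p ∈ A) {t h : G} (ht : ∀ y ∈ A, t • y ∈ A) (ht' : ∀ y ∈ A, t⁻¹ • y ∈ A)
    (hτ : dist (π (h • p)) p ≤ τ) (hτ' : dist (π (h⁻¹ • p)) p ≤ τ) (hK : κ + 4 * κ + τ ≤ K)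
    (hgap : 3 * K < dist p (h • p)) (hlong : 9 * K + 1 ≤ dist p (t • p)) :
    IsGateChain K (fun i : ℤ => fun x => (t * h) ^ i • π (((t * h) ^ i)⁻¹ • x))
      (fun i => (t * h) ^ i • p) (fun i => (t * h) ^ i • t • p) := by
  have hκ := hA.nonneg p
  have hτ0 : 0 ≤ τ := dist_nonneg.trans hτ
  have hsucc : ∀ i : ℤ, (t * h) ^ (i + 1) • p = (t * h) ^ i • t • h • p := fun i => by
    rw [zpow_add_one, mul_smul, mul_smul]
  refine ⟨fun i x y => ?_, fun i => ?_, fun i => ?_, fun i => ?_, fun i => ?_, fun i => ?_⟩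
  · rcases (hA.smul ((t * h) ^ i)).proj x y with h1 | h1
    · left; linarith
    · right; linarith
  · simp only [inv_smul_smul, dist_smul]
    linarith [hA.fix p hp]
  · simp only [hsucc, inv_smul_smul, dist_smul]
    -- Coarse equivariance of `π` under `t` moves the hypothesis on `h • p` from `p` to the exit
    -- point `t • p`.
    have h1 := hA.dist_proj_smul_le ht ht' (h • p)
    have h2 := dist_triangle (π (t • h • p)) (t • π (h • p)) (t • p)
    rw [dist_smul t] at h2
    linarith
  · have h1 : ((t * h) ^ (i + 1))⁻¹ • (t * h) ^ i • t • p = h⁻¹ • p := by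
      rw [zpow_add_one, ← mul_smul, ← mul_smul]
      congr 1; group
    simp only [h1, dist_smul]
    linarith
  · simpa only [hsucc, dist_smul] using hgap
  · simpa only [dist_smul] using hlong

end Orbit

/-! ### Extending an element to a contracting one -/

section Extension

variable {G X : Type*} [Group G] [MetricSpace X] [MulAction G X] [IsIsometricSMul G X]

/-- All conjugates of `g * f` are contracting, with a stable length not much smaller than the
displacement of `g`. -/
def IsGoodExtension (p : X) (C : ℝ) (g f : G) : Prop :=
  ∀ k : G, IsContractingElement p (k * (g * f) * k⁻¹) ∧
    dist p (g • p) - C ≤ stableLength p (k * (g * f) * k⁻¹)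

/-- The chain gives a gate on the orbit of `w` and linear progress by at least the gap per step,
hence contraction and the bound on stable length. Conjugation changes displacements of powers only
by a constant independent of the power. -/
theorem IsGateChain.isGoodExtension {K : ℝ} {π : ℤ → X → X} {f : ℤ → X} {p : X} {w : G}
    (hc : IsGateChain K π (fun i => w ^ i • p) f) {g v k : G} (hw : k * w * k⁻¹ = g * v) {C : ℝ}
    (hgap : ∀ i, dist p (g • p) - C ≤ dist (f i) (w ^ (i + 1) • p)) :
    IsGoodExtension p C g v := by
  have hstep : ∀ i : ℤ, dist (w ^ i • p) (w ^ (i + 1) • p) ≤ dist p (w • p) := fun i => by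
    rw [dist_zpow_smul_zpow_smul, add_sub_cancel_left, zpow_one]
  obtain ⟨κ, π', hgate⟩ := hc.exists_isGate hstep
  have hqi : IsQIEmbeddingInt fun n : ℤ => w ^ n • p := by
    have hup : ∀ n : ℕ, dist p (w ^ n • p) ≤ n * dist p (w • p) := by
      intro n
      induction n with
      | zero => simp
      | succ n ih =>
        have h1 := dist_triangle p (w ^ n • p) (w ^ (n + 1) • p)
        rw [pow_succ, mul_smul, dist_smul] at h1
        push_cast
        rw [pow_succ, mul_smul]
        linarith
    refine ⟨max 1 (dist p (w • p)), 0, le_max_left _ _, le_rfl, fun m n => ⟨?_, ?_⟩⟩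
    · have h1 := hc.abs_sub_le_dist m n
      have h2 : 1 / max 1 (dist p (w • p)) * |(m : ℝ) - n| ≤ |(m : ℝ) - n| :=
        mul_le_of_le_one_left (abs_nonneg _)
          (div_le_one_of_le₀ (le_max_left _ _) (zero_le_one.trans (le_max_left _ _)))
      linarith
    · wlog hmn : m ≤ n generalizing m n
      · rw [dist_comm, abs_sub_comm]; exact this n m (by omega)
      obtain ⟨j, rfl⟩ := Int.le.dest hmn
      rw [dist_zpow_smul_zpow_smul, add_sub_cancel_left, zpow_natCast]
      push_cast
      rw [sub_add_cancel_left, abs_neg, abs_of_nonneg (Nat.cast_nonneg j), add_zero]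
      refine (hup j).trans ?_
      rw [mul_comm]
      exact mul_le_mul_of_nonneg_right (le_max_right _ _) (Nat.cast_nonneg j)
  intro u
  have hconj : u * (g * v) * u⁻¹ = (u * k) * w * (u * k)⁻¹ := by rw [← hw]; group
  rw [hconj]
  refine ⟨isContractingElement_conj hgate hqi _,
    le_stableLength (c := 2 * dist ((u * k)⁻¹ • p) p) fun n => ?_⟩
  have h1 := hc.mul_le_dist hgap 0 n
  have h2 : dist p (w ^ n • p) ≤
      dist p ((u * k * w * (u * k)⁻¹) ^ n • p) + 2 * dist ((u * k)⁻¹ • p) p := by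
    have h3 := dist_conj_zpow_smul_le p (u * k) w n
    rw [zpow_natCast, zpow_natCast] at h3
    have h4 := dist_triangle4_right p (w ^ n • p) ((u * k)⁻¹ • p) (w ^ n • p)
    have h5 : dist ((u * k)⁻¹ • p) (w ^ n • p) = dist p ((u * k) • w ^ n • p) := by
      rw [← dist_smul (u * k), smul_inv_smul]
    have h6 := dist_triangle p ((u * k * w * (u * k)⁻¹) ^ n • p) ((u * k) • w ^ n • p)
    rw [dist_self, add_zero] at h4
    rw [dist_comm p ((u * k)⁻¹ • p)] at h4
    linarith
  simp only [zpow_zero, one_smul, zero_add, zpow_natCast] at h1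
  have : (0 : ℝ) ≤ n := Nat.cast_nonneg n
  linarith

open Classical in
/-- There is a finite family of elements of which, for every given `g`, more than half are good
extensions of `g`. -/
theorem HasContractingProperty.exists_family (hX : IsGeodesicSpace X) {p : X}
    (hG : HasContractingProperty G p) :
    ∃ (F : Fin 5 × Fin 5 → G) (C : ℝ), ∀ g : G,
      (Finset.univ.filter fun s => ¬ IsGoodExtension p C g (F s)).card ≤ 10 := by
  obtain ⟨a, b, ⟨haY, haq⟩, ⟨hbY, hbq⟩, R, hR⟩ := hG
  obtain ⟨κ, π, hA⟩ := haY.exists_isGate hX ⟨p, mem_cyclicOrbit p a⟩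
  obtain ⟨κ', π', hB⟩ := hbY.exists_isGate hX ⟨p, mem_cyclicOrbit p b⟩
  obtain ⟨τ, hτ⟩ := hA.near_or_near hX hB hR (mem_cyclicOrbit p a) (mem_cyclicOrbit p b)
  set K := κ + 4 * κ + max τ 0 with hK
  obtain ⟨n, hn⟩ := exists_lt_dist_zpow haq (9 * K + 1)
  set T := max τ (3 * K + 4 * κ') with hT
  obtain ⟨M, hM⟩ := exists_lt_dist_zpow hbq (2 * T + 8 * κ')
  -- By coarse equivariance the five translates of `z` have projections pairwise more than `2 * T`
  -- apart, so at most one lies within `T` of `p`.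
  have hproj : ∀ (z : X) (i j : Fin 5), dist (π' (b ^ ((M : ℤ) * i) • z)) p ≤ T →
      dist (π' (b ^ ((M : ℤ) * j) • z)) p ≤ T → i = j := by
    intro z i j hi hj
    by_contra hij
    have heq : ∀ m : ℤ, dist (π' (b ^ m • z)) (b ^ m • π' z) ≤ 4 * κ' := fun m =>
      hB.dist_proj_smul_le (fun y hy => zpow_smul_mem_cyclicOrbit b m hy)
        (fun y hy => by rw [← zpow_neg]; exact zpow_smul_mem_cyclicOrbit b _ hy) z
    obtain ⟨m, hm⟩ := hB.mem z
    have h1 := hM ((M : ℤ) * i + m) ((M : ℤ) * j + m) (by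
      rw [add_sub_add_right_eq_sub, ← mul_sub, abs_mul, Nat.abs_cast]
      refine le_mul_of_one_le_right (by positivity) (Int.one_le_abs ?_)
      intro h0
      exact hij (Fin.ext (by omega)))
    rw [zpow_add, zpow_add, mul_smul, mul_smul, show b ^ m • p = π' z from hm] at h1
    have h2 := dist_triangle4_left (π' (b ^ ((M : ℤ) * i) • z)) (π' (b ^ ((M : ℤ) * j) • z))
      (b ^ ((M : ℤ) * i) • π' z) (b ^ ((M : ℤ) * j) • π' z)
    have h3 := dist_triangle_right (π' (b ^ ((M : ℤ) * i) • z))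
      (π' (b ^ ((M : ℤ) * j) • z)) p
    linarith [heq ((M : ℤ) * i), heq ((M : ℤ) * j)]
  set v : Fin 5 → G := fun i => b ^ ((M : ℤ) * i) with hv
  set D : ℝ := ∑ i, dist p (v i • p) with hD
  have hDv : ∀ i, dist p (v i • p) ≤ D := fun i =>
    Finset.single_le_sum (f := fun i => dist p (v i • p)) (fun _ _ => dist_nonneg)
      (Finset.mem_univ i)
  -- With this choice `g * F s` is conjugate to `a ^ n * h`, where `h = v s.1 * g * (v s.2)⁻¹` has
  -- displacement within `2 * D` of that of `g`. Once one index is fixed, each of the conditions on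
  -- `h` and `h⁻¹` excludes at most one value of the other. Five powers suffice because `2 * (5 + 5)
  -- < 25`.
  refine ⟨fun s => (v s.2)⁻¹ * a ^ n * v s.1, 2 * D, fun g => ?_⟩
  set bad₁ : Finset (Fin 5 × Fin 5) := Finset.univ.filter fun s =>
    dist (π' (v s.1 • (g * (v s.2)⁻¹) • p)) p ≤ T with hbad₁
  set bad₂ : Finset (Fin 5 × Fin 5) := Finset.univ.filter fun s =>
    dist (π' (v s.2 • (g⁻¹ * (v s.1)⁻¹) • p)) p ≤ T with hbad₂
  have hcard₁ : bad₁.card ≤ 5 := by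
    refine (Finset.card_le_card_of_injOn (t := (Finset.univ : Finset (Fin 5))) Prod.snd
      (fun _ _ => by simp) ?_).trans (by simp)
    rintro ⟨i, j⟩ h1 ⟨i', j'⟩ h2 (rfl : j = j')
    simp only [hbad₁, Finset.coe_filter, Finset.mem_univ, true_and, Set.mem_ofPred_eq] at h1 h2
    rw [hproj _ i i' h1 h2]
  have hcard₂ : bad₂.card ≤ 5 := by
    refine (Finset.card_le_card_of_injOn (t := (Finset.univ : Finset (Fin 5))) Prod.fst
      (fun _ _ => by simp) ?_).trans (by simp)
    rintro ⟨i, j⟩ h1 ⟨i', j'⟩ h2 (rfl : i = i')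
    simp only [hbad₂, Finset.coe_filter, Finset.mem_univ, true_and, Set.mem_ofPred_eq] at h1 h2
    rw [hproj _ j j' h1 h2]
  refine (Finset.card_le_card (t := bad₁ ∪ bad₂) fun s hs => ?_).trans
    ((Finset.card_union_le _ _).trans (by omega))
  by_contra hcon
  simp only [hbad₁, hbad₂, Finset.mem_union, Finset.mem_filter, Finset.mem_univ, true_and, not_or,
    not_le] at hcon hs
  obtain ⟨hc1, hc2⟩ := hcon
  refine hs ?_
  set h : G := v s.1 * g * (v s.2)⁻¹ with hh
  have hhp : v s.1 • (g * (v s.2)⁻¹) • p = h • p := by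
    rw [hh, ← mul_smul, mul_assoc]
  have hhp' : v s.2 • (g⁻¹ * (v s.1)⁻¹) • p = h⁻¹ • p := by
    rw [hh, ← mul_smul]; congr 1; group
  rw [hhp] at hc1
  rw [hhp'] at hc2
  have hτT : τ ≤ T := le_max_left _ _
  have hτK : τ ≤ max τ 0 := le_max_left _ _
  -- The second term in `T` serves here: a projection farther than `3 * K + 4 * κ'` from `p` forces
  -- a large displacement.
  have hgap : 3 * K < dist p (h • p) := by
    have h1 := hB.dist_add_dist_le (h • p) (mem_cyclicOrbit p b)
    have h2 : 3 * K + 4 * κ' ≤ T := le_max_right _ _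
    rw [dist_comm p]
    linarith [dist_nonneg (x := h • p) (y := π' (h • p))]
  have hchain := hA.isGateChain (mem_cyclicOrbit p a) (t := a ^ n) (h := h) (τ := max τ 0) (K := K)
    (fun y hy => by rw [← zpow_natCast]; exact zpow_smul_mem_cyclicOrbit a _ hy)
    (fun y hy => by rw [← zpow_natCast, ← zpow_neg]; exact zpow_smul_mem_cyclicOrbit a _ hy)
    (((hτ _).resolve_right (by linarith)).trans hτK)
    (((hτ _).resolve_right (by linarith)).trans hτK) le_rfl hgap
    (by
      have h1 := hn 0 n (by simp)
      rw [zpow_zero, one_smul, zpow_natCast] at h1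
      exact h1.le)
  refine hchain.isGoodExtension (k := g * (v s.2)⁻¹) (by rw [hh]; group) fun i => ?_
  rw [zpow_add_one, mul_smul, mul_smul, dist_smul, dist_smul]
  have h1 : dist p (g • p) = dist (v s.1 • p) (h • v s.2 • p) := by
    rw [hh, ← dist_smul (v s.1), ← mul_smul, ← mul_smul, inv_mul_cancel_right]
  have h2 := dist_triangle4_right (v s.1 • p) (h • v s.2 • p) p (h • p)
  rw [dist_smul] at h2
  linarith [hDv s.1, hDv s.2, dist_comm p (v s.1 • p), dist_comm p (v s.2 • p)]

end Extension

/-! ### Both actions at once -/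

open Classical in
/-- If, in a finite product, more than half of every row satisfies one predicate and more than
half of every column satisfies another one, then some pair satisfies both. -/
theorem exists_pair_of_card_lt {α β : Type*} [Fintype α] [Fintype β] [Nonempty α] [Nonempty β]
    {P Q : α → β → Prop}
    (hP : ∀ b, 2 * (Finset.univ.filter fun a => ¬ P a b).card < Fintype.card α)
    (hQ : ∀ a, 2 * (Finset.univ.filter fun b => ¬ Q a b).card < Fintype.card β) :
    ∃ a b, P a b ∧ Q a b := by
  by_contra! hcon
  -- If no pair works, every pair is bad for `P` or for `Q`, yet each kind accounts for less than
  -- half of the product.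
  have h1 : Fintype.card α * Fintype.card β ≤
      ∑ b, (Finset.univ.filter fun a => ¬ P a b).card +
        ∑ a, (Finset.univ.filter fun b => ¬ Q a b).card := by
    simp only [Finset.card_filter]
    rw [Finset.sum_comm, ← Finset.sum_add_distrib]
    simp only [← Finset.sum_add_distrib]
    calc Fintype.card α * Fintype.card β = ∑ _a : α, ∑ _b : β, 1 := by simp
      _ ≤ _ := Finset.sum_le_sum fun a _ => Finset.sum_le_sum fun b _ => by
        by_cases h : P a b
        · simp [h, hcon a b h]
        · simp [h]
  have h2 : ∑ b, 2 * (Finset.univ.filter fun a => ¬ P a b).card < ∑ _b : β, Fintype.card α :=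
    Finset.sum_lt_sum_of_nonempty Finset.univ_nonempty fun b _ => hP b
  have h3 : ∑ a, 2 * (Finset.univ.filter fun b => ¬ Q a b).card < ∑ _a : α, Fintype.card β :=
    Finset.sum_lt_sum_of_nonempty Finset.univ_nonempty fun a _ => hQ a
  simp only [← Finset.mul_sum, Finset.sum_const, Finset.card_univ, smul_eq_mul] at h2 h3
  rw [mul_comm (Fintype.card β)] at h2
  omega

/-- For two actions with contracting property, every group element is at bounded distance from a
simultaneously contracting one whose stable lengths are almost as large as its displacements. -/
theorem exists_simultaneouslyContracting {G X₁ X₂ : Type*} [Group G]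
    [MetricSpace X₁] [MulAction G X₁] [IsIsometricSMul G X₁]
    [MetricSpace X₂] [MulAction G X₂] [IsIsometricSMul G X₂]
    (hX₁ : IsGeodesicSpace X₁) (hX₂ : IsGeodesicSpace X₂) {p₁ : X₁} {p₂ : X₂}
    (hG₁ : HasContractingProperty G p₁) (hG₂ : HasContractingProperty G p₂) :
    ∃ C : ℝ, 0 ≤ C ∧ ∀ g : G, ∃ w ∈ simultaneouslyContracting G p₁ p₂,
      dist p₁ (g • p₁) - C ≤ stableLength p₁ w ∧ stableLength p₁ w ≤ dist p₁ (g • p₁) + C ∧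
      dist p₂ (g • p₂) - C ≤ stableLength p₂ w ∧ stableLength p₂ w ≤ dist p₂ (g • p₂) + C := by
  obtain ⟨F₁, C₁, h₁⟩ := hG₁.exists_family hX₁
  obtain ⟨F₂, C₂, h₂⟩ := hG₂.exists_family hX₂
  set D₁ : ℝ := ∑ s, ∑ t, dist p₁ ((F₁ s * F₂ t) • p₁)
  set D₂ : ℝ := ∑ s, ∑ t, dist p₂ ((F₁ s * F₂ t) • p₂)
  set E₁ : ℝ := ∑ t, dist p₁ (F₂ t • p₁)
  set E₂ : ℝ := ∑ s, dist p₂ (F₁ s • p₂)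
  have hD₁ : ∀ s t, dist p₁ ((F₁ s * F₂ t) • p₁) ≤ D₁ := fun s t =>
    (Finset.single_le_sum (f := fun t => dist p₁ ((F₁ s * F₂ t) • p₁))
      (fun _ _ => dist_nonneg) (Finset.mem_univ t)).trans
      (Finset.single_le_sum (f := fun s => ∑ t, dist p₁ ((F₁ s * F₂ t) • p₁))
        (fun _ _ => Finset.sum_nonneg fun _ _ => dist_nonneg) (Finset.mem_univ s))
  have hD₂ : ∀ s t, dist p₂ ((F₁ s * F₂ t) • p₂) ≤ D₂ := fun s t =>
    (Finset.single_le_sum (f := fun t => dist p₂ ((F₁ s * F₂ t) • p₂))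
      (fun _ _ => dist_nonneg) (Finset.mem_univ t)).trans
      (Finset.single_le_sum (f := fun s => ∑ t, dist p₂ ((F₁ s * F₂ t) • p₂))
        (fun _ _ => Finset.sum_nonneg fun _ _ => dist_nonneg) (Finset.mem_univ s))
  have hE₁ : ∀ t, dist p₁ (F₂ t • p₁) ≤ E₁ := fun t =>
    Finset.single_le_sum (f := fun t => dist p₁ (F₂ t • p₁)) (fun _ _ => dist_nonneg)
      (Finset.mem_univ t)
  have hE₂ : ∀ s, dist p₂ (F₁ s • p₂) ≤ E₂ := fun s =>
    Finset.single_le_sum (f := fun s => dist p₂ (F₁ s • p₂)) (fun _ _ => dist_nonneg)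
      (Finset.mem_univ s)
  have hD₁0 : 0 ≤ D₁ := dist_nonneg.trans (hD₁ 0 0)
  have hD₂0 : 0 ≤ D₂ := dist_nonneg.trans (hD₂ 0 0)
  have hE₁0 : 0 ≤ E₁ := dist_nonneg.trans (hE₁ 0)
  have hE₂0 : 0 ≤ E₂ := dist_nonneg.trans (hE₂ 0)
  have hC₁ := le_abs_self C₁
  have hC₂ := le_abs_self C₂
  have hC₁0 := abs_nonneg C₁
  have hC₂0 := abs_nonneg C₂
  refine ⟨D₁ + D₂ + E₁ + E₂ + |C₁| + |C₂|, by positivity, fun g => ?_⟩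
  obtain ⟨s, t, hs, ht⟩ := exists_pair_of_card_lt
    (P := fun s t => IsGoodExtension p₁ C₁ (F₂ t * g) (F₁ s))
    (Q := fun s t => IsGoodExtension p₂ C₂ (g * F₁ s) (F₂ t))
    (fun t => by
      have := h₁ (F₂ t * g)
      simp only [Fintype.card_prod, Fintype.card_fin]
      omega)
    (fun s => by
      have := h₂ (g * F₁ s)
      simp only [Fintype.card_prod, Fintype.card_fin]
      omega)
  -- Conjugating by `(F₂ t)⁻¹` turns `F₂ t * g * F₁ s` into `g * F₁ s * F₂ t`, so both extensions
  -- speak of the same element.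
  obtain ⟨hs1, hs2⟩ := hs (F₂ t)⁻¹
  obtain ⟨ht1, ht2⟩ := ht 1
  have hw₁ : (F₂ t)⁻¹ * (F₂ t * g * F₁ s) * (F₂ t)⁻¹⁻¹ = g * (F₁ s * F₂ t) := by group
  have hw₂ : 1 * (g * F₁ s * F₂ t) * 1⁻¹ = g * (F₁ s * F₂ t) := by group
  rw [hw₁] at hs1 hs2
  rw [hw₂] at ht1 ht2
  have a1 := stableLength_le_dist p₁ (g * (F₁ s * F₂ t))
  have a2 := stableLength_le_dist p₂ (g * (F₁ s * F₂ t))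
  have b1 := dist_triangle p₁ (g • p₁) ((g * (F₁ s * F₂ t)) • p₁)
  have b2 := dist_triangle p₂ (g • p₂) ((g * (F₁ s * F₂ t)) • p₂)
  rw [mul_smul g, dist_smul g] at b1 b2
  rw [mul_smul g] at a1 a2
  have c1 := dist_triangle_left (F₂ t • p₁) ((F₂ t * g) • p₁) p₁
  have c2 := dist_triangle_right p₂ (g • p₂) ((g * F₁ s) • p₂)
  rw [mul_smul, dist_smul] at c1
  rw [mul_smul, dist_smul] at c2
  rw [mul_smul] at hs2 ht2
  refine ⟨_, ⟨hs1, ht1⟩, ?_, ?_, ?_, ?_⟩ <;>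
    linarith [hD₁ s t, hD₂ s t, hE₁ t, hE₂ s]

theorem abs_dist_smul_smul_sub_le {G X : Type*} [Group G] [MetricSpace X] [MulAction G X]
    [IsIsometricSMul G X] (o p : X) (g h : G) :
    |dist (g • o) (h • o) - dist p ((g⁻¹ * h) • p)| ≤ 2 * dist o p := by
  have h1 : dist p ((g⁻¹ * h) • p) = dist (g • p) (h • p) := by
    rw [← dist_smul g p, ← mul_smul, mul_inv_cancel_left]
  have h2 := dist_triangle4_left (g • o) (h • o) (g • p) (h • p)
  have h3 := dist_triangle4_right (g • o) (h • o) (g • p) (h • p)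
  simp only [dist_smul] at h2 h3
  rw [h1, abs_le]
  constructor <;> linarith

end MLS

theorem mainTheorem2 {G X₁ X₂ : Type*} [Group G]
    [MetricSpace X₁] [MulAction G X₁] [IsIsometricSMul G X₁]
    [MetricSpace X₂] [MulAction G X₂] [IsIsometricSMul G X₂]
    (hX₁ : MLS.IsGeodesicSpace X₁) (hX₂ : MLS.IsGeodesicSpace X₂)
    (p₁ : X₁) (p₂ : X₂)
    (hG₁ : MLS.HasContractingProperty G p₁) (hG₂ : MLS.HasContractingProperty G p₂)
    (lam₁ lam₂ : ℝ) (hlam₁ : 0 ≤ lam₁) (hlam₂ : 0 ≤ lam₂)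
    (hSC : ∀ g ∈ MLS.simultaneouslyContracting G p₁ p₂,
      lam₁ * MLS.stableLength p₂ g ≤ MLS.stableLength p₁ g ∧
        MLS.stableLength p₁ g ≤ lam₂ * MLS.stableLength p₂ g) :
    ∀ (o₁ : X₁) (o₂ : X₂), ∃ C : ℝ, 0 ≤ C ∧ ∀ g h : G,
      lam₁ * dist (g • o₂) (h • o₂) - C ≤ dist (g • o₁) (h • o₁) ∧
        dist (g • o₁) (h • o₁) ≤ lam₂ * dist (g • o₂) (h • o₂) + C := by

  obtain ⟨C, hC, hw⟩ := MLS.exists_simultaneouslyContracting hX₁ hX₂ hG₁ hG₂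
  intro o₁ o₂
  have hd₁ : 0 ≤ dist o₁ p₁ := dist_nonneg
  have hd₂ : 0 ≤ dist o₂ p₂ := dist_nonneg
  refine ⟨(lam₁ + lam₂ + 1) * (C + 2 * dist o₁ p₁ + 2 * dist o₂ p₂), by positivity,
    fun g h => ?_⟩
  -- By invariance the distance between the two orbit points is, up to the change of base point, the
  -- displacement of `g⁻¹ * h`.
  obtain ⟨w, hwS, h1, h2, h3, h4⟩ := hw (g⁻¹ * h)
  obtain ⟨hl, hu⟩ := hSC w hwS
  obtain ⟨a1, a2⟩ := abs_le.1 (MLS.abs_dist_smul_smul_sub_le o₁ p₁ g h)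
  obtain ⟨b1, b2⟩ := abs_le.1 (MLS.abs_dist_smul_smul_sub_le o₂ p₂ g h)
  have e1 : lam₁ * dist (g • o₂) (h • o₂) ≤
      lam₁ * (MLS.stableLength p₂ w + (C + 2 * dist o₂ p₂)) :=
    mul_le_mul_of_nonneg_left (by linarith) hlam₁
  have e2 : lam₂ * MLS.stableLength p₂ w ≤
      lam₂ * (dist (g • o₂) (h • o₂) + (C + 2 * dist o₂ p₂)) :=
    mul_le_mul_of_nonneg_left (by linarith) hlam₂
  have f1 : 0 ≤ lam₁ * (C + 2 * dist o₂ p₂) := by positivity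
  have f2 : 0 ≤ lam₂ * (C + 2 * dist o₂ p₂) := by positivity
  have f3 : 0 ≤ lam₁ * dist o₁ p₁ := by positivity
  have f4 : 0 ≤ lam₂ * dist o₁ p₁ := by positivity
  constructor <;> linarith
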